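/- All graphs are finite and simple. For graphs $F,G$, $F+G$ denotes the disjoint union, $2F=F+F$, $\overline{F}$ is the complement of $F$, and $P_t$ is the path on $t$ vertices; a graph is $(F_1,\ldots,F_p)$-free if it contains none of $F_1,\ldots,F_p$ as an induced subgraph. An atom is a graph $G$ with no clique $K\subseteq V(G)$ (possibly empty) such that $G\setminus K$ is disconnected. The clique-width of a graph is the minimum number of labels needed to construct it by the operations: create a single vertex with label $i$; take the disjoint union of two labelled graphs; add all edges between the vertices labelled $i$ and those labelled $j$ ($i\ne j$); relabel all vertices labelled $i$ to $j$. A class of graphs has unbounded clique-width if no constant bounds the clique-width of all its members. The class of $(\overline{P_2+P_3},\overline{P_1+2P_2},P_1+2P_2,P_6)$-free atoms has unbounded clique-width. Moreover, the following graphs witness this. For $n\ge 2$, let $W_n$ be the wall of height $n$: its vertices are the pairs $(x,y)$ with $0\le x\le 2n+1$ and $0\le y\le n$, where $(x,y)$ is adjacent to $(x+1,y)$, and $(x,y)$ is adjacent to $(x,y+1)$ whenever $x+y$ is odd, with the two vertices of degree one deleted (namely $(0,0)$, and $(2n+1,n)$ if $n$ is even or $(0,n)$ if $n$ is odd). Let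 $H_n$ be obtained from $W_n$ by replacing every edge $uv$ with a path $u,e,v$ through a new subdivision vertex $e$, adding all edges between distinct original vertices of $W_n$, and adding one new vertex adjacent to exactly the subdivision vertices. Then every $H_n$ with $n\ge 2$ is a $(\overline{P_2+P_3},\overline{P_1+2P_2},P_1+2P_2,P_6)$-free atom, and the set $\{H_n : n\ge 2\}$ has unbounded clique-width. -/

import Mathlib

/-- Terms over the four clique-width operations, with label set `Fin k`. -/
inductive CWTerm (k : ℕ) : Type
  /-- create a single vertex with label `i` -/
  | vertex (i : Fin k) : CWTerm k
  /-- disjoint union of two labelled graphs -/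
  | union (s t : CWTerm k) : CWTerm k
  /-- add all edges between label `i` and label `j`, where `i ≠ j` -/
  | join (i j : Fin k) (hij : i ≠ j) (t : CWTerm k) : CWTerm k
  /-- relabel every vertex with label `i` to have label `j` -/
  | relabel (i j : Fin k) (t : CWTerm k) : CWTerm k

namespace CWTerm

/-- The vertex set of the labelled graph that a term constructs. -/
def Verts {k : ℕ} : CWTerm k → Type
  | vertex _ => Unit
  | union s t => s.Verts ⊕ t.Verts
  | join _ _ _ t => t.Verts
  | relabel _ _ t => t.Verts

/-- The labels of the vertices of the labelled graph that a term constructs. -/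
def label {k : ℕ} : (t : CWTerm k) → t.Verts → Fin k
  | vertex i => fun _ => i
  | union s t => Sum.elim s.label t.label
  | join _ _ _ t => t.label
  | relabel i j t => fun v => if t.label v = i then j else t.label v

/-- The graph that a term constructs. -/
def graph {k : ℕ} : (t : CWTerm k) → SimpleGraph t.Verts
  | vertex _ => (⊥ : SimpleGraph Unit)
  | union s t => SimpleGraph.sum s.graph t.graph
  | join i j hij t =>
    { Adj := fun u v => t.graph.Adj u v ∨ (t.label u = i ∧ t.label v = j) ∨
        (t.label u = j ∧ t.label v = i)
      symm := ⟨fun u v h => by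
        rcases h with h | h | h
        · exact Or.inl h.symm
        · exact Or.inr (Or.inr ⟨h.2, h.1⟩)
        · exact Or.inr (Or.inl ⟨h.2, h.1⟩)⟩
      loopless := ⟨fun u h => by
        rcases h with h | h | h
        · exact t.graph.loopless.irrefl u h
        · exact hij (h.1.symm.trans h.2)
        · exact hij (h.2.symm.trans h.1)⟩ }
  | relabel _ _ t => t.graph

end CWTerm

/-- The clique-width of a finite graph: the minimum number of labels needed to construct it.
Every finite nonempty graph can be constructed; the empty graph gets the value `0`. -/
noncomputable def cliqueWidth {V : Type} (G : SimpleGraph V) : ℕ :=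
  sInf {k : ℕ | ∃ t : CWTerm k, Nonempty (t.graph ≃g G)}

/-- A class of graphs has bounded clique-width if some constant bounds the clique-width
of all its (finite) members. -/
def HasBoundedCliqueWidth (𝒢 : ∀ V : Type, SimpleGraph V → Prop) : Prop :=
  ∃ c : ℕ, ∀ (V : Type) [Finite V] (G : SimpleGraph V), 𝒢 V G → cliqueWidth G ≤ c

/-- A clique `K` is a clique cut-set of `G` if `G ∖ K` is disconnected, i.e. has two vertices
that no walk joins. (The empty set is a clique; the graph on no vertices is not disconnected.) -/
def IsCliqueCutset {V : Type} (G : SimpleGraph V) (K : Set V) : Prop :=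
  G.IsClique K ∧ ¬ (G.induce Kᶜ).Preconnected

/-- An atom is a graph without clique cut-sets. -/
def IsAtomGraph {V : Type} (G : SimpleGraph V) : Prop :=
  ∀ K : Set V, ¬ IsCliqueCutset G K

/-- `G` is `H`-free if it does not contain `H` as an induced subgraph. -/
def InducedFree {W V : Type} (H : SimpleGraph W) (G : SimpleGraph V) : Prop :=
  ¬ H.IsIndContained G

/-- The graph `P₂ + P₃`. -/
abbrev graphP2P3 : SimpleGraph (Fin 2 ⊕ Fin 3) :=
  SimpleGraph.sum (SimpleGraph.pathGraph 2) (SimpleGraph.pathGraph 3)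

/-- The graph `P₁ + 2P₂`. -/
abbrev graphP1P2P2 : SimpleGraph (Fin 1 ⊕ (Fin 2 ⊕ Fin 2)) :=
  SimpleGraph.sum (SimpleGraph.pathGraph 1)
    (SimpleGraph.sum (SimpleGraph.pathGraph 2) (SimpleGraph.pathGraph 2))

/-- The class of `(co-(P₂ + P₃), co-(P₁ + 2P₂), P₁ + 2P₂, P₆)`-free atoms. -/
def FreeAtom (V : Type) (G : SimpleGraph V) : Prop :=
  InducedFree graphP2P3ᶜ G ∧ InducedFree graphP1P2P2ᶜ G ∧ InducedFree graphP1P2P2 G ∧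
    InducedFree (SimpleGraph.pathGraph 6) G ∧ IsAtomGraph G

/-- The vertices `(x, y)` of the wall of height `h`: there are `h + 1` rows `y = 0, …, h`, each
with columns `x = 0, …, 2h + 1`, without the two corners that would have degree one. -/
abbrev WallVertex (h : ℕ) : Type :=
  {p : Fin (2 * h + 2) × Fin (h + 1) //
    ¬ ((p.1 : ℕ) = 0 ∧ (p.2 : ℕ) = 0) ∧
    ¬ ((p.1 : ℕ) = (if Even h then 2 * h + 1 else 0) ∧ (p.2 : ℕ) = h)}

/-- The wall of height `h`: horizontally consecutive vertices are adjacent, and `(x, y)` is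
adjacent to `(x, y + 1)` whenever `x + y` is odd. -/
def wall (h : ℕ) : SimpleGraph (WallVertex h) :=
  SimpleGraph.fromRel fun p q =>
    ((p.1.1 : ℕ) + 1 = q.1.1 ∧ (p.1.2 : ℕ) = q.1.2) ∨
    ((p.1.1 : ℕ) = q.1.1 ∧ (p.1.2 : ℕ) + 1 = q.1.2 ∧ Odd ((p.1.1 : ℕ) + p.1.2))

/-- The 1-subdivision of `G`: every edge `e = uv` is replaced by a path `u, e, v`. -/
def oneSubdivision {V : Type} (G : SimpleGraph V) : SimpleGraph (V ⊕ G.edgeSet) :=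
  SimpleGraph.fromRel fun a b => ∃ (v : V) (e : G.edgeSet),
    a = Sum.inl v ∧ b = Sum.inr e ∧ v ∈ (e : Sym2 V)

/-- The 1-subdivision of `G` with the original vertices of `G` made into a clique, together with
a new vertex `none` that is adjacent to exactly the subdivision vertices. -/
def cliqueSubdivisionWithApex {V : Type} (G : SimpleGraph V) :
    SimpleGraph (Option (V ⊕ G.edgeSet)) :=
  SimpleGraph.fromRel fun a b =>
    (∃ u v : V ⊕ G.edgeSet, a = some u ∧ b = some v ∧ (oneSubdivision G).Adj u v) ∨
    (∃ u v : V, a = some (Sum.inl u) ∧ b = some (Sum.inl v)) ∨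
    (∃ e : G.edgeSet, a = none ∧ b = some (Sum.inr e))

/-! Original vertices form a clique, subdivision vertices an independent set, and the apex sees
exactly the latter. A finite check shows that these three kinds cannot be arranged as three of the
forbidden graphs. The fourth, co-(P₂ + P₃), fits only if two subdivision vertices share both ends,
hence are one edge. The atom property needs only minimum degree two in the wall.

For clique-width, a subterm of a k-label term yields a set X with at most k types of neighbourhoods
outside X, holding a balanced share of a prescribed set (`exists_balanced_of_cliqueWidth`). If X
splits several disjoint connected sets of the wall, their members yield vertices of different types
(`card_le_of_crossing`), so few rows and few columns are split. Balance then gives an unsplit column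
inside X and another outside X, while an unsplit row meets both: a contradiction
(`lt_cliqueWidth_of_grid`). -/

theorem Set.ncard_image_inter {α β : Type*} {f : α → β} (hf : f.Injective) (X : Set α)
    (S : Set β) : (f '' X ∩ S).ncard = (X ∩ f ⁻¹' S).ncard := by
  rw [← Set.ncard_image_of_injective _ hf, Set.image_inter_preimage]

/-! ### Clique-width terms and balanced subterms -/

namespace CWTerm

variable {k : ℕ}

instance finite_verts : (t : CWTerm k) → Finite t.Verts
  | vertex _ => inferInstanceAs (Finite Unit)
  | union s t => by
    have := finite_verts s
    have := finite_verts t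
    exact inferInstanceAs (Finite (s.Verts ⊕ t.Verts))
  | join _ _ _ t => finite_verts t
  | relabel _ _ t => finite_verts t

/-- Every assignment of labels to a finite nonempty set is realised by an edgeless term. -/
theorem exists_edgeless (α : Type) [Finite α] :
    Nonempty α → ∀ f : α → Fin k,
      ∃ (t : CWTerm k) (e : t.Verts ≃ α), (∀ v, t.label v = f (e v)) ∧ t.graph = ⊥ := by
  induction α using Finite.induction_empty_option with
  | of_equiv e ih =>
    intro hne f
    obtain ⟨t, e', hl, hg⟩ := ih (e.nonempty_congr.2 hne) (f ∘ e)
    exact ⟨t, e'.trans e, hl, hg⟩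
  | h_empty => exact fun h => h.elim fun a => a.elim
  | @h_option α _ ih =>
    intro _ f
    rcases isEmpty_or_nonempty α with hα | hα
    · refine ⟨vertex (f none), (Equiv.ofUnique Unit (Option α) : Unit ≃ Option α),
        fun v => ?_, rfl⟩
      change f none = _
      exact congrArg f (Subsingleton.elim _ _)
    · obtain ⟨t, e, hl, hg⟩ := ih hα (f ∘ some)
      let e' : Unit ⊕ t.Verts ≃ Option α :=
        (Equiv.sumComm _ _).trans ((Equiv.optionEquivSumPUnit _).symm.trans e.optionCongr)
      refine ⟨union (vertex (f none)) t, e', ?_, ?_⟩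
      · rintro (v | v)
        · rfl
        · exact hl v
      · ext u v
        rcases u with u | u <;> rcases v with v | v
        · exact Iff.rfl
        · exact iff_of_false (by rintro ⟨⟩) id
        · exact iff_of_false (by rintro ⟨⟩) id
        · change t.graph.Adj u v ↔ False
          simp [hg]

/-- Every finite nonempty graph is constructed by a term. -/
theorem exists_iso {V : Type} [Finite V] [Nonempty V] (G : SimpleGraph V) :
    ∃ (k : ℕ) (t : CWTerm k), Nonempty (t.graph ≃g G) := by
  classical
  have := Fintype.ofFinite V
  let f : V ≃ Fin (Fintype.card V) := Fintype.equivFin V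
  -- All labels stay distinct, so each `join` adds exactly one edge.
  have key : ∀ s : Finset (Sym2 V), ∃ (t : CWTerm (Fintype.card V)) (e : t.Verts ≃ V),
      (∀ v, t.label v = f (e v)) ∧
      ∀ u v, t.graph.Adj u v ↔ (SimpleGraph.fromEdgeSet (s : Set (Sym2 V))).Adj (e u) (e v) := by
    intro s
    induction s using Finset.induction_on with
    | empty =>
      obtain ⟨t, e, hl, hg⟩ := exists_edgeless V ‹_› f
      exact ⟨t, e, hl, by simp [hg]⟩
    | insert a s _ ih =>
      obtain ⟨t, e, hl, hg⟩ := ih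
      induction a using Sym2.ind with
      | _ a b =>
        by_cases hab : a = b
        · refine ⟨t, e, hl, fun u v => ?_⟩
          rw [hg]
          simp only [SimpleGraph.fromEdgeSet_adj, Finset.coe_insert, Set.mem_insert_iff,
            Sym2.eq_iff]
          grind
        · refine ⟨join (f a) (f b) (f.injective.ne hab) t, e, hl, fun u v => ?_⟩
          change (t.graph.Adj u v ∨ (t.label u = f a ∧ t.label v = f b) ∨
            (t.label u = f b ∧ t.label v = f a)) ↔ _
          refine (or_congr (hg u v) (by rw [hl u, hl v])).trans ?_
          simp only [SimpleGraph.fromEdgeSet_adj, Finset.coe_insert, Set.mem_insert_iff,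
            Finset.mem_coe, Sym2.eq_iff, f.injective.eq_iff]
          generalize e u = x at *
          generalize e v = y at *
          generalize (s(x, y) ∈ s) = p
          grind
  obtain ⟨t, e, -, hg⟩ := key G.edgeFinset
  exact ⟨_, t, ⟨⟨e, fun {u v} => by rw [hg]; simp⟩⟩⟩

/-- A subterm that contains a prescribed share of `S`: its vertices `X` have at most `k`
types of neighbourhoods outside `X`. -/
theorem exists_balanced (t : CWTerm k) : ∀ (S : Set t.Verts) (w : ℕ), 1 ≤ w → w ≤ S.ncard →
    ∃ (X : Set t.Verts) (lab : t.Verts → Fin k), w ≤ (X ∩ S).ncard ∧ (X ∩ S).ncard ≤ 2 * w ∧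
      ∀ u ∈ X, ∀ v ∈ X, lab u = lab v →
        t.label u = t.label v ∧ ∀ y ∉ X, t.graph.Adj u y ↔ t.graph.Adj v y := by
  have whole : ∀ (t : CWTerm k) (S : Set t.Verts) (w : ℕ), w ≤ S.ncard → S.ncard ≤ 2 * w →
      ∃ (X : Set t.Verts) (lab : t.Verts → Fin k), w ≤ (X ∩ S).ncard ∧ (X ∩ S).ncard ≤ 2 * w ∧
        ∀ u ∈ X, ∀ v ∈ X, lab u = lab v →
          t.label u = t.label v ∧ ∀ y ∉ X, t.graph.Adj u y ↔ t.graph.Adj v y :=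
    fun t S w h1 h2 => ⟨Set.univ, t.label, by simpa using h1, by simpa using h2,
      fun u _ v _ h => ⟨h, fun y hy => (hy trivial).elim⟩⟩
  induction t with
  | vertex i =>
    intro S w hw hS
    refine whole _ S w hS ?_
    have : S.ncard ≤ Nat.card (vertex i).Verts := Set.ncard_le_card S
    have h1 : Nat.card (vertex i).Verts = 1 := Nat.card_unique (α := Unit)
    omega
  | union s t ihs iht =>
    intro S w hw hS
    by_cases h2 : S.ncard ≤ 2 * w
    · exact whole _ S w hS h2
    have hsum : S.ncard = (Sum.inl ⁻¹' S : Set s.Verts).ncard +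
        (Sum.inr ⁻¹' S : Set t.Verts).ncard := by
      rw [← Set.ncard_image_of_injective (Sum.inl ⁻¹' S : Set s.Verts)
          (Sum.inl_injective (β := t.Verts)),
        ← Set.ncard_image_of_injective (Sum.inr ⁻¹' S : Set t.Verts)
          (Sum.inr_injective (α := s.Verts)), ← Set.ncard_union_eq]
      · exact congrArg _ (Set.image_preimage_inl_union_image_preimage_inr S).symm
      · rw [Set.disjoint_left]
        rintro _ ⟨a, -, rfl⟩ ⟨b, -, h⟩
        cases h
    -- More than `2 * w` elements of `S`: one side has at least `w`, and the search descends there.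
    -- Values of the new labelling on the other side are immaterial.
    rcases (by omega : w ≤ (Sum.inl ⁻¹' S : Set s.Verts).ncard ∨
        w ≤ (Sum.inr ⁻¹' S : Set t.Verts).ncard) with h | h
    · obtain ⟨X, lab, hX1, hX2, hX⟩ := ihs _ w hw h
      have hc : ((Sum.inl '' X : Set (s.Verts ⊕ t.Verts)) ∩ S).ncard
          = (X ∩ Sum.inl ⁻¹' S).ncard :=
        Set.ncard_image_inter Sum.inl_injective X S
      refine ⟨(Sum.inl '' X : Set (s.Verts ⊕ t.Verts)), Sum.elim lab t.label,
        hc ▸ hX1, hc ▸ hX2, ?_⟩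
      rintro _ ⟨u, hu, rfl⟩ _ ⟨v, hv, rfl⟩ huv
      refine ⟨(hX u hu v hv huv).1, ?_⟩
      rintro (y | y) hy
      · exact (hX u hu v hv huv).2 y fun h => hy ⟨y, h, rfl⟩
      · exact Iff.rfl
    · obtain ⟨X, lab, hX1, hX2, hX⟩ := iht _ w hw h
      have hc : ((Sum.inr '' X : Set (s.Verts ⊕ t.Verts)) ∩ S).ncard
          = (X ∩ Sum.inr ⁻¹' S).ncard :=
        Set.ncard_image_inter Sum.inr_injective X S
      refine ⟨(Sum.inr '' X : Set (s.Verts ⊕ t.Verts)), Sum.elim s.label lab,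
        hc ▸ hX1, hc ▸ hX2, ?_⟩
      rintro _ ⟨u, hu, rfl⟩ _ ⟨v, hv, rfl⟩ huv
      refine ⟨(hX u hu v hv huv).1, ?_⟩
      rintro (y | y) hy
      · exact Iff.rfl
      · exact (hX u hu v hv huv).2 y fun h => hy ⟨y, h, rfl⟩
  | join i j hij t ih =>
    intro S w hw hS
    obtain ⟨X, lab, hX1, hX2, hX⟩ := ih S w hw hS
    refine ⟨X, lab, hX1, hX2, fun u hu v hv huv => ?_⟩
    obtain ⟨hl, ha⟩ := hX u hu v hv huv
    refine ⟨hl, fun y hy => ?_⟩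
    change (t.graph.Adj u y ∨ _ ∨ _) ↔ (t.graph.Adj v y ∨ _ ∨ _)
    -- The edges added by `join` depend only on labels; this is why the induction also carries
    -- equality of labels.
    rw [ha y hy, hl]
  | relabel i j t ih =>
    intro S w hw hS
    obtain ⟨X, lab, hX1, hX2, hX⟩ := ih S w hw hS
    refine ⟨X, lab, hX1, hX2, fun u hu v hv huv => ?_⟩
    obtain ⟨hl, ha⟩ := hX u hu v hv huv
    refine ⟨?_, ha⟩
    change (if t.label u = i then j else t.label u) = if t.label v = i then j else t.label v
    rw [hl]

end CWTerm

/-- In a finite nonempty graph `G`, any vertex set `S` is split in a balanced way by some `X` whose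
vertices have at most `cliqueWidth G` types of neighbourhoods outside `X`. -/
theorem exists_balanced_of_cliqueWidth {V : Type} [Finite V] [Nonempty V] (G : SimpleGraph V)
    (S : Set V) (w : ℕ) (hw : 1 ≤ w) (hS : w ≤ S.ncard) :
    ∃ (X : Set V) (lab : V → Fin (cliqueWidth G)), w ≤ (X ∩ S).ncard ∧ (X ∩ S).ncard ≤ 2 * w ∧
      ∀ u ∈ X, ∀ v ∈ X, lab u = lab v → ∀ y ∉ X, G.Adj u y ↔ G.Adj v y := by
  -- The infimum is attained because some term exists; this fails for the empty graph.
  obtain ⟨t, ⟨e⟩⟩ : ∃ t : CWTerm (cliqueWidth G), Nonempty (t.graph ≃g G) :=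
    Nat.sInf_mem (s := {k : ℕ | ∃ t : CWTerm k, Nonempty (t.graph ≃g G)}) (CWTerm.exists_iso G)
  have card : ∀ Y : Set V, (e ⁻¹' Y).ncard = Y.ncard := fun Y => by
    rw [← Set.ncard_image_of_injective _ e.injective, Set.image_preimage_eq _ e.surjective]
  obtain ⟨X, lab, hX1, hX2, hX⟩ := t.exists_balanced (e ⁻¹' S) w hw (by rwa [card])
  have hc : (e.symm ⁻¹' X ∩ S).ncard = (X ∩ e ⁻¹' S).ncard := by
    rw [← card]
    congr 1
    ext v
    simp
  refine ⟨e.symm ⁻¹' X, lab ∘ e.symm, hc ▸ hX1, hc ▸ hX2, fun u hu v hv huv y hy => ?_⟩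
  have := (hX _ hu _ hv huv).2 (e.symm y) hy
  rwa [e.symm.map_adj_iff, e.symm.map_adj_iff] at this

/-! ### Forbidden induced subgraphs and clique cut-sets -/

section CliqueSubdivisionWithApex

variable {V : Type} {G : SimpleGraph V}

@[simp] theorem oneSubdivision_adj_inl_inl (u v : V) :
    ¬ (oneSubdivision G).Adj (Sum.inl u) (Sum.inl v) := by
  simp [oneSubdivision]

@[simp] theorem oneSubdivision_adj_inr_inr (e f : G.edgeSet) :
    ¬ (oneSubdivision G).Adj (Sum.inr e) (Sum.inr f) := by
  simp [oneSubdivision]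

@[simp] theorem oneSubdivision_adj_inl_inr (v : V) (e : G.edgeSet) :
    (oneSubdivision G).Adj (Sum.inl v) (Sum.inr e) ↔ v ∈ (e : Sym2 V) := by
  simp [oneSubdivision]

@[simp] theorem cliqueSubdivisionWithApex_adj_inl_inl (u v : V) :
    (cliqueSubdivisionWithApex G).Adj (some (Sum.inl u)) (some (Sum.inl v)) ↔ u ≠ v := by
  simp [cliqueSubdivisionWithApex]

@[simp] theorem cliqueSubdivisionWithApex_adj_inl_inr (v : V) (e : G.edgeSet) :
    (cliqueSubdivisionWithApex G).Adj (some (Sum.inl v)) (some (Sum.inr e)) ↔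
      v ∈ (e : Sym2 V) := by
  simp [cliqueSubdivisionWithApex, SimpleGraph.adj_comm]

@[simp] theorem cliqueSubdivisionWithApex_adj_inr_inl (v : V) (e : G.edgeSet) :
    (cliqueSubdivisionWithApex G).Adj (some (Sum.inr e)) (some (Sum.inl v)) ↔
      v ∈ (e : Sym2 V) := by
  rw [SimpleGraph.adj_comm, cliqueSubdivisionWithApex_adj_inl_inr]

@[simp] theorem cliqueSubdivisionWithApex_adj_inr_inr (e f : G.edgeSet) :
    ¬ (cliqueSubdivisionWithApex G).Adj (some (Sum.inr e)) (some (Sum.inr f)) := by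
  simp [cliqueSubdivisionWithApex]

@[simp] theorem cliqueSubdivisionWithApex_adj_none_inl (v : V) :
    ¬ (cliqueSubdivisionWithApex G).Adj none (some (Sum.inl v)) := by
  simp [cliqueSubdivisionWithApex]

@[simp] theorem cliqueSubdivisionWithApex_adj_inl_none (v : V) :
    ¬ (cliqueSubdivisionWithApex G).Adj (some (Sum.inl v)) none := by
  simp [cliqueSubdivisionWithApex]

@[simp] theorem cliqueSubdivisionWithApex_adj_none_inr (e : G.edgeSet) :
    (cliqueSubdivisionWithApex G).Adj none (some (Sum.inr e)) := by
  simp [cliqueSubdivisionWithApex]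

@[simp] theorem cliqueSubdivisionWithApex_adj_inr_none (e : G.edgeSet) :
    (cliqueSubdivisionWithApex G).Adj (some (Sum.inr e)) none := by
  simp [cliqueSubdivisionWithApex]

/-- The kind of a vertex: `0` for original vertices, `1` for subdivision vertices, `2` for the
apex. -/
def vertexKind : Option (V ⊕ G.edgeSet) → Fin 3
  | some (Sum.inl _) => 0
  | some (Sum.inr _) => 1
  | none => 2

/-- Whether two distinct vertices with kinds `a`, `b` can be adjacent (for `adj = true`),
respectively non-adjacent (for `adj = false`). -/
def kindsOk : (adj : Bool) → (a b : Fin 3) → Bool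
  | true, 0, 0 | true, 0, 1 | true, 1, 0 | true, 1, 2 | true, 2, 1 => true
  | false, 0, 1 | false, 1, 0 | false, 1, 1 | false, 0, 2 | false, 2, 0 => true
  | _, _, _ => false

theorem kindsOk_of_embedding {W : Type} {F : SimpleGraph W} [DecidableRel F.Adj]
    (f : F ↪g cliqueSubdivisionWithApex G) (a b : W) (hab : a ≠ b) :
    kindsOk (decide (F.Adj a b)) (vertexKind (f a)) (vertexKind (f b)) := by
  have hne : f a ≠ f b := f.injective.ne hab
  have hadj : F.Adj a b ↔ (cliqueSubdivisionWithApex G).Adj (f a) (f b) := f.map_adj_iff.symm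
  have hdec : ∀ d : Bool, (d = true ↔ (cliqueSubdivisionWithApex G).Adj (f a) (f b)) →
      kindsOk d (vertexKind (f a)) (vertexKind (f b)) := by
    revert hne
    generalize f a = x
    generalize f b = y
    rcases x with _ | x | x <;> rcases y with _ | y | y <;> rintro hne (_ | _) <;>
      simp_all [vertexKind, kindsOk]
  exact hdec _ (decide_eq_true_iff.trans hadj)

instance pathGraphDecidableAdj (n : ℕ) : DecidableRel (SimpleGraph.pathGraph n).Adj :=
  fun _ _ => decidable_of_iff _ SimpleGraph.pathGraph_adj.symm

instance sumDecidableAdj {α β : Type} (F : SimpleGraph α) (F' : SimpleGraph β)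
    [DecidableRel F.Adj] [DecidableRel F'.Adj] : DecidableRel (SimpleGraph.sum F F').Adj
  | .inl a, .inl b => inferInstanceAs (Decidable (F.Adj a b))
  | .inr a, .inr b => inferInstanceAs (Decidable (F'.Adj a b))
  | .inl _, .inr _ => isFalse nofun
  | .inr _, .inl _ => isFalse nofun

/-- No kinds of vertices fit the path on six vertices. -/
theorem kinds_pathGraph_six : ∀ c0 : Fin 3,
    ∀ c1 : Fin 3, kindsOk true c0 c1 →
    ∀ c2 : Fin 3, kindsOk false c0 c2 → kindsOk true c1 c2 →
    ∀ c3 : Fin 3, kindsOk false c0 c3 → kindsOk false c1 c3 → kindsOk true c2 c3 →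
    ∀ c4 : Fin 3, kindsOk false c0 c4 → kindsOk false c1 c4 → kindsOk false c2 c4 →
      kindsOk true c3 c4 →
    ∀ c5 : Fin 3, kindsOk false c0 c5 → kindsOk false c1 c5 → kindsOk false c2 c5 →
      kindsOk false c3 c5 → kindsOk true c4 c5 →
    False := by
  decide

/-- Two edges without the apex would each contain an original vertex, and these would be adjacent.
So one edge has kinds 1, 2 and the other 0, 0, which leaves no kind for the isolated vertex. Each
premise comes right after its last variable, so `decide` prunes early. -/
theorem kinds_P1P2P2 : ∀ c0 : Fin 3,
    ∀ c1 : Fin 3, kindsOk false c0 c1 →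
    ∀ c2 : Fin 3, kindsOk false c0 c2 → kindsOk true c1 c2 →
    ∀ c3 : Fin 3, kindsOk false c0 c3 → kindsOk false c1 c3 → kindsOk false c2 c3 →
    ∀ c4 : Fin 3, kindsOk false c0 c4 → kindsOk false c1 c4 → kindsOk false c2 c4 →
      kindsOk true c3 c4 →
    False := by
  decide

theorem kinds_compl_P1P2P2 : ∀ c0 : Fin 3,
    ∀ c1 : Fin 3, kindsOk true c0 c1 →
    ∀ c2 : Fin 3, kindsOk true c0 c2 → kindsOk false c1 c2 →
    ∀ c3 : Fin 3, kindsOk true c0 c3 → kindsOk true c1 c3 → kindsOk true c2 c3 →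
    ∀ c4 : Fin 3, kindsOk true c0 c4 → kindsOk true c1 c4 → kindsOk true c2 c4 →
      kindsOk false c3 c4 →
    False := by
  decide

/-- In the surviving pattern `c3` is the apex, and the subdivision vertices `c0`, `c1` have the
common ends `c2`, `c4`. -/
theorem kinds_compl_P2P3 : ∀ c0 : Fin 3,
    ∀ c1 : Fin 3, kindsOk false c0 c1 →
    ∀ c2 : Fin 3, kindsOk true c0 c2 → kindsOk true c1 c2 →
    ∀ c3 : Fin 3, kindsOk true c0 c3 → kindsOk true c1 c3 → kindsOk false c2 c3 →
    ∀ c4 : Fin 3, kindsOk true c0 c4 → kindsOk true c1 c4 → kindsOk true c2 c4 →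
      kindsOk false c3 c4 →
    (c0 = 1 ∧ c1 = 1 ∧ c2 = 0 ∧ c4 = 0) := by
  decide

/-- At most two path vertices are original. Subdivision vertices number at most two if the apex
occurs, being its neighbours, and at most three otherwise, being independent. Either way at most
five vertices are covered. -/
theorem pathGraph_six_free :
    InducedFree (SimpleGraph.pathGraph 6) (cliqueSubdivisionWithApex G) := by
  rintro ⟨f⟩
  have h := kindsOk_of_embedding f
  exact kinds_pathGraph_six _
    _ (h 0 1 (by decide))
    _ (h 0 2 (by decide)) (h 1 2 (by decide))
    _ (h 0 3 (by decide)) (h 1 3 (by decide)) (h 2 3 (by decide))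
    _ (h 0 4 (by decide)) (h 1 4 (by decide)) (h 2 4 (by decide)) (h 3 4 (by decide))
    _ (h 0 5 (by decide)) (h 1 5 (by decide)) (h 2 5 (by decide)) (h 3 5 (by decide))
      (h 4 5 (by decide))

theorem graphP1P2P2_free : InducedFree graphP1P2P2 (cliqueSubdivisionWithApex G) := by
  rintro ⟨f⟩
  have h := kindsOk_of_embedding f
  exact kinds_P1P2P2 _
    _ (h (.inl 0) (.inr (.inl 0)) nofun)
    _ (h (.inl 0) (.inr (.inl 1)) nofun) (h (.inr (.inl 0)) (.inr (.inl 1)) nofun)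
    _ (h (.inl 0) (.inr (.inr 0)) nofun) (h (.inr (.inl 0)) (.inr (.inr 0)) nofun)
      (h (.inr (.inl 1)) (.inr (.inr 0)) nofun)
    _ (h (.inl 0) (.inr (.inr 1)) nofun) (h (.inr (.inl 0)) (.inr (.inr 1)) nofun)
      (h (.inr (.inl 1)) (.inr (.inr 1)) nofun) (h (.inr (.inr 0)) (.inr (.inr 1)) nofun)

theorem compl_graphP1P2P2_free : InducedFree graphP1P2P2ᶜ (cliqueSubdivisionWithApex G) := by
  rintro ⟨f⟩
  have h := kindsOk_of_embedding f
  exact kinds_compl_P1P2P2 _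
    _ (h (.inl 0) (.inr (.inl 0)) nofun)
    _ (h (.inl 0) (.inr (.inl 1)) nofun) (h (.inr (.inl 0)) (.inr (.inl 1)) nofun)
    _ (h (.inl 0) (.inr (.inr 0)) nofun) (h (.inr (.inl 0)) (.inr (.inr 0)) nofun)
      (h (.inr (.inl 1)) (.inr (.inr 0)) nofun)
    _ (h (.inl 0) (.inr (.inr 1)) nofun) (h (.inr (.inl 0)) (.inr (.inr 1)) nofun)
      (h (.inr (.inl 1)) (.inr (.inr 1)) nofun) (h (.inr (.inr 0)) (.inr (.inr 1)) nofun)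

theorem compl_graphP2P3_free : InducedFree graphP2P3ᶜ (cliqueSubdivisionWithApex G) := by
  rintro ⟨f⟩
  have h := kindsOk_of_embedding f
  obtain ⟨h0, h1, h2, h4⟩ := kinds_compl_P2P3 _
    _ (h (.inl 0) (.inl 1) nofun)
    _ (h (.inl 0) (.inr 0) nofun) (h (.inl 1) (.inr 0) nofun)
    _ (h (.inl 0) (.inr 1) nofun) (h (.inl 1) (.inr 1) nofun) (h (.inr 0) (.inr 1) nofun)
    _ (h (.inl 0) (.inr 2) nofun) (h (.inl 1) (.inr 2) nofun) (h (.inr 0) (.inr 2) nofun)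
      (h (.inr 1) (.inr 2) nofun)
  have inl_of : ∀ x : Option (V ⊕ G.edgeSet), vertexKind x = 0 → ∃ v, x = some (.inl v) := by
    rintro (_ | v | e) <;> simp [vertexKind]
  have inr_of : ∀ x : Option (V ⊕ G.edgeSet), vertexKind x = 1 → ∃ e, x = some (.inr e) := by
    rintro (_ | v | e) <;> simp [vertexKind]
  obtain ⟨a, ha⟩ := inr_of _ h0
  obtain ⟨b, hb⟩ := inr_of _ h1
  obtain ⟨u, hu⟩ := inl_of _ h2
  obtain ⟨v, hv⟩ := inl_of _ h4
  have adj : ∀ x y, graphP2P3ᶜ.Adj x y → (cliqueSubdivisionWithApex G).Adj (f x) (f y) :=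
    fun x y => f.map_adj_iff.2
  have hua := adj (.inl 0) (.inr 0) (by decide)
  have hva := adj (.inl 0) (.inr 2) (by decide)
  have hub := adj (.inl 1) (.inr 0) (by decide)
  have hvb := adj (.inl 1) (.inr 2) (by decide)
  have huv := adj (.inr 0) (.inr 2) (by decide)
  rw [ha, hu, cliqueSubdivisionWithApex_adj_inr_inl] at hua
  rw [ha, hv, cliqueSubdivisionWithApex_adj_inr_inl] at hva
  rw [hb, hu, cliqueSubdivisionWithApex_adj_inr_inl] at hub
  rw [hb, hv, cliqueSubdivisionWithApex_adj_inr_inl] at hvb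
  rw [hu, hv, cliqueSubdivisionWithApex_adj_inl_inl] at huv
  have hab : a = b := Subtype.ext
    (((Sym2.mem_and_mem_iff huv).1 ⟨hua, hva⟩).trans ((Sym2.mem_and_mem_iff huv).1 ⟨hub, hvb⟩).symm)
  have := f.injective (ha.trans (hab ▸ hb.symm))
  simp at this

/-- If all degrees in `G` are at least two, then `cliqueSubdivisionWithApex G` has no clique
cut-set. -/
theorem isAtomGraph_cliqueSubdivisionWithApex
    (hdeg : ∀ v : V, ∃ a b, a ≠ b ∧ G.Adj v a ∧ G.Adj v b) :
    IsAtomGraph (cliqueSubdivisionWithApex G) := by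
  rintro K ⟨hK, hcon⟩
  refine hcon ?_
  have unique : ∀ e f : G.edgeSet, some (Sum.inr e) ∈ K → some (Sum.inr f) ∈ K → e = f := by
    intro e f he hf
    by_contra hef
    exact cliqueSubdivisionWithApex_adj_inr_inr e f (hK he hf (by simpa using hef))
  have step : ∀ (x y : Option (V ⊕ G.edgeSet)) (hx : x ∈ Kᶜ) (hy : y ∈ Kᶜ),
      (cliqueSubdivisionWithApex G).Adj x y →
      ((cliqueSubdivisionWithApex G).induce Kᶜ).Reachable ⟨x, hx⟩ ⟨y, hy⟩ :=
    fun x y hx hy h => SimpleGraph.Adj.reachable (by exact h)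
  have incident : ∀ v : V, ∃ e : G.edgeSet, v ∈ (e : Sym2 V) ∧ some (Sum.inr e) ∉ K := by
    intro v
    obtain ⟨a, b, hab, ha, hb⟩ := hdeg v
    by_contra! h
    have := unique _ _ (h ⟨s(v, a), ha⟩ (Sym2.mem_mk_left _ _))
      (h ⟨s(v, b), hb⟩ (Sym2.mem_mk_left _ _))
    exact hab (Sym2.congr_right.1 (congrArg Subtype.val this))
  -- A clique with the apex contains no original vertex, so the original clique survives and every
  -- subdivision vertex attaches to it. Otherwise the apex survives as a hub: `K` has at most one
  -- subdivision vertex, so each original vertex keeps an incident one.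
  by_cases hapex : none ∈ K
  · have hV : ∀ v : V, some (Sum.inl v) ∈ Kᶜ := fun v hv =>
      cliqueSubdivisionWithApex_adj_none_inl v (hK hapex hv (by simp))
    have toV : ∀ x : (Kᶜ : Set (Option (V ⊕ G.edgeSet))), ∃ v : V,
        ((cliqueSubdivisionWithApex G).induce Kᶜ).Reachable x ⟨some (Sum.inl v), hV v⟩ := by
      rintro ⟨_ | v | e, hx⟩
      · exact (hx hapex).elim
      · exact ⟨v, .refl _⟩
      · exact ⟨(e : Sym2 V).out.1, step _ _ _ _ (by simp [Sym2.out_fst_mem])⟩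
    intro x y
    obtain ⟨u, hu⟩ := toV x
    obtain ⟨v, hv⟩ := toV y
    refine hu.trans (SimpleGraph.Reachable.trans ?_ hv.symm)
    by_cases huv : u = v
    · subst huv
      exact .refl _
    · exact step _ _ _ _ (by simpa using huv)
  · have toApex : ∀ x : (Kᶜ : Set (Option (V ⊕ G.edgeSet))),
        ((cliqueSubdivisionWithApex G).induce Kᶜ).Reachable x ⟨none, hapex⟩ := by
      rintro ⟨_ | v | e, hx⟩
      · exact .refl _
      · obtain ⟨e, he, heK⟩ := incident v
        exact (step _ (some (Sum.inr e)) hx heK (by simpa using he)).trans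
          (step _ _ _ _ (by simp))
      · exact step _ _ _ _ (by simp)
    exact fun x y => (toApex x).trans (toApex y).symm

end CliqueSubdivisionWithApex

/-! ### Grid-like structures force large clique-width -/

section LowerBound

variable {V : Type} {G : SimpleGraph V}

/-- The vertices of `P` induce a connected subgraph of `G`: no partition of `P` into two nonempty
parts is without crossing edges. -/
def IsConnectedIn (G : SimpleGraph V) (P : Set V) : Prop :=
  ∀ X : Set V, (∀ p ∈ P, ∀ q ∈ P, G.Adj p q → p ∈ X → q ∈ X) →
    ∀ p ∈ P, ∀ q ∈ P, p ∈ X → q ∈ X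

/-- If `X` splits each member of a family of disjoint connected sets of `G`, then `X` has at least
as many types of neighbourhoods outside `X` as the family has members. -/
theorem card_le_of_crossing {m k : ℕ} {P : Fin m → Set V}
    (hconn : ∀ i, IsConnectedIn G (P i)) (hdisj : ∀ i j v, v ∈ P i → v ∈ P j → i = j)
    (X : Set (Option (V ⊕ G.edgeSet))) (lab : Option (V ⊕ G.edgeSet) → Fin k)
    (hX : ∀ u ∈ X, ∀ v ∈ X, lab u = lab v → ∀ y ∉ X,
      (cliqueSubdivisionWithApex G).Adj u y ↔ (cliqueSubdivisionWithApex G).Adj v y)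
    (I : Set (Fin m))
    (hcross : ∀ i ∈ I, ∃ p ∈ P i, ∃ q ∈ P i, some (Sum.inl p) ∈ X ∧ some (Sum.inl q) ∉ X) :
    I.ncard ≤ k := by
  -- Some half-edge of the subdivision within `P i` has its ends on different sides of `X`;
  -- otherwise membership in `X` would spread over all of `P i`.
  have edge : ∀ i ∈ I, ∃ (v : V) (e : G.edgeSet), v ∈ (e : Sym2 V) ∧
      (∀ w ∈ (e : Sym2 V), w ∈ P i) ∧
      ((some (Sum.inl v) ∈ X ∧ some (Sum.inr e) ∉ X) ∨
        (some (Sum.inr e) ∈ X ∧ some (Sum.inl v) ∉ X)) := by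
    intro i hi
    obtain ⟨p, hp, q, hq, hpX, hqX⟩ := hcross i hi
    by_contra! h
    refine hqX (hconn i {v | some (Sum.inl v) ∈ X} (fun a ha b hb hab haX => ?_) p hp q hq hpX)
    have hmem : ∀ w ∈ s(a, b), w ∈ P i := by
      intro w hw
      rcases Sym2.mem_iff.1 hw with rfl | rfl <;> assumption
    have he := (h a ⟨s(a, b), hab⟩ (Sym2.mem_mk_left _ _) hmem).1 haX
    exact (h b ⟨s(a, b), hab⟩ (Sym2.mem_mk_right _ _) hmem).2 he
  rcases I.eq_empty_or_nonempty with rfl | ⟨i₀, hi₀⟩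
  · simp
  obtain ⟨v₀, e₀, -⟩ := edge i₀ hi₀
  have : Nonempty V := ⟨v₀⟩
  have : Nonempty G.edgeSet := ⟨e₀⟩
  choose! v e hve heP hcase using edge
  -- The end of the half-edge that lies in `X`.
  let x : Fin m → Option (V ⊕ G.edgeSet) := fun i =>
    open Classical in
      if some (Sum.inl (v i)) ∈ X then some (Sum.inl (v i)) else some (Sum.inr (e i))
  have hinj : Set.InjOn (fun i => lab (x i)) I := by
    intro i hi j hj hij
    by_contra hne
    simp only [x] at hij
    have hP : ∀ w, w ∈ (e i : Sym2 V) → w ∈ (e j : Sym2 V) → False := fun w h1 h2 =>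
      hne (hdisj i j w (heP i hi w h1) (heP j hj w h2))
    -- In the mixed cases the outside vertex tested is the subdivision vertex: originals are
    -- pairwise adjacent, so an original one would not distinguish the two.
    rcases hcase i hi with ⟨h1, h2⟩ | ⟨h1, h2⟩ <;> rcases hcase j hj with ⟨h3, h4⟩ | ⟨h3, h4⟩
    · rw [if_pos h1, if_pos h3] at hij
      have := hX _ h1 _ h3 hij _ h2
      simp only [cliqueSubdivisionWithApex_adj_inl_inr] at this
      exact hP _ (this.1 (hve i hi)) (hve j hj)
    · rw [if_pos h1, if_neg h4] at hij
      have := hX _ h1 _ h3 hij _ h2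
      simp only [cliqueSubdivisionWithApex_adj_inl_inr, cliqueSubdivisionWithApex_adj_inr_inr,
        iff_false] at this
      exact this (hve i hi)
    · rw [if_neg h2, if_pos h3] at hij
      have := hX _ h1 _ h3 hij _ h4
      simp only [cliqueSubdivisionWithApex_adj_inl_inr, cliqueSubdivisionWithApex_adj_inr_inr,
        false_iff] at this
      exact this (hve j hj)
    · rw [if_neg h2, if_neg h4] at hij
      have := hX _ h1 _ h3 hij _ h2
      simp only [cliqueSubdivisionWithApex_adj_inr_inl] at this
      exact hP _ (hve i hi) (this.1 (hve i hi))
  calc I.ncard ≤ (Set.univ : Set (Fin k)).ncard :=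
        Set.ncard_le_ncard_of_injOn (fun i => lab (x i)) (fun _ _ => trivial) hinj
    _ = k := by rw [Set.ncard_univ, Nat.card_fin]

/-- A grid-like structure in `G`, formed by `m` disjoint connected rows and `m` disjoint connected
columns that meet each row, forces large clique-width. -/
theorem lt_cliqueWidth_of_grid [Finite V] {m c : ℕ} (hm : 3 * c + 3 ≤ m) {R C : Fin m → Set V}
    (hR : ∀ i, IsConnectedIn G (R i)) (hRdisj : ∀ i j v, v ∈ R i → v ∈ R j → i = j)
    (hC : ∀ i, IsConnectedIn G (C i)) (hCdisj : ∀ i j v, v ∈ C i → v ∈ C j → i = j)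
    (hRC : ∀ i j, (R i ∩ C j).Nonempty) :
    c < cliqueWidth (cliqueSubdivisionWithApex G) := by
  by_contra! hk
  have : NeZero m := ⟨by omega⟩
  choose p hp using hRC
  let s : Fin m → Option (V ⊕ G.edgeSet) := fun j => some (Sum.inl (p 0 j))
  have hs : s.Injective := fun i j h => by
    simp only [s, Option.some.injEq, Sum.inl.injEq] at h
    exact hCdisj i j (p 0 i) (hp 0 i).2 (h ▸ (hp 0 j).2)
  -- One sample per column, all in row 0. Between `c + 1` and `2 * c + 2` of the at least `3 * c +
  -- 3` samples lie in `X`, so at least `c + 1` lie outside: more columns on each side than can be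
  -- split.
  obtain ⟨X, lab, hX1, hX2, hX⟩ := exists_balanced_of_cliqueWidth (cliqueSubdivisionWithApex G)
    (Set.range s) (c + 1) (by omega) (by
      rw [← Set.image_univ, Set.ncard_image_of_injective _ hs, Set.ncard_univ, Nat.card_fin]
      omega)
  have hcount : (X ∩ Set.range s).ncard = (s ⁻¹' X).ncard := by
    rw [← Set.ncard_image_of_injective _ hs, Set.image_preimage_eq_inter_range]
  rw [hcount] at hX1 hX2
  have hcompl : (s ⁻¹' X).ncard + (s ⁻¹' X)ᶜ.ncard = m := by
    rw [Set.ncard_add_ncard_compl, Nat.card_fin]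
  have uncrossed : ∀ (P : Fin m → Set V), (∀ i, IsConnectedIn G (P i)) →
      (∀ i j v, v ∈ P i → v ∈ P j → i = j) → ∀ I : Set (Fin m), c < I.ncard →
      ∃ i ∈ I, ∀ a ∈ P i, ∀ b ∈ P i, some (Sum.inl a) ∈ X → some (Sum.inl b) ∈ X := by
    intro P hP hPd I hI
    by_contra! h
    have := card_le_of_crossing hP hPd X lab hX I h
    omega
  obtain ⟨i, -, hi⟩ := uncrossed R hR hRdisj Set.univ (by
    rw [Set.ncard_univ, Nat.card_fin]; omega)
  obtain ⟨j, hjX, hj⟩ := uncrossed C hC hCdisj (s ⁻¹' X) (by omega)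
  obtain ⟨l, hlX, hl⟩ := uncrossed C hC hCdisj (s ⁻¹' X)ᶜ (by omega)
  have h1 := hj _ (hp 0 j).2 _ (hp i j).2 hjX
  have h2 := hi _ (hp i j).1 _ (hp i l).1 h1
  exact hlX (hl _ (hp i l).2 _ (hp 0 l).2 h2)

end LowerBound

/-! ### Degrees, rows and columns of the wall -/

section Wall

variable {n : ℕ}

/-- The pair `(x, y)` is a vertex of the wall of height `n`. -/
def IsWallPos (n x y : ℕ) : Prop :=
  x < 2 * n + 2 ∧ y < n + 1 ∧ ¬ (x = 0 ∧ y = 0) ∧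
    ¬ (x = (if Even n then 2 * n + 1 else 0) ∧ y = n)

/-- The vertex `(x, y)` of a wall. -/
def wallPos {x y : ℕ} (h : IsWallPos n x y) : WallVertex n :=
  ⟨(⟨x, h.1⟩, ⟨y, h.2.1⟩), h.2.2⟩

theorem wallVertex_induction {p : WallVertex n → Prop}
    (h : ∀ x y (hxy : IsWallPos n x y), p (wallPos hxy)) (v : WallVertex n) : p v :=
  h v.1.1 v.1.2 ⟨v.1.1.2, v.1.2.2, v.2⟩

theorem wall_adj_horizontal {x y : ℕ} (h : IsWallPos n x y) (h' : IsWallPos n (x + 1) y) :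
    (wall n).Adj (wallPos h) (wallPos h') := by
  simp [wall, wallPos]

theorem wall_adj_vertical {x y : ℕ} (h : IsWallPos n x y) (h' : IsWallPos n x (y + 1))
    (hodd : Odd (x + y)) : (wall n).Adj (wallPos h) (wallPos h') := by
  simp [wall, wallPos, hodd]

theorem wallPos_inj {x y x' y' : ℕ} (h : IsWallPos n x y) (h' : IsWallPos n x' y') :
    wallPos h = wallPos h' ↔ x = x' ∧ y = y' := by
  simp [wallPos]

/-- Every vertex has a horizontal neighbour; a second is vertical or, where no vertical edge exists,
the other horizontal one. -/
theorem wall_two_neighbors (hn : 2 ≤ n) (v : WallVertex n) :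
    ∃ a b, a ≠ b ∧ (wall n).Adj v a ∧ (wall n).Adj v b := by
  induction v using wallVertex_induction with
  | h x y h =>
    have right : IsWallPos n (x + 1) y → ∃ h' : IsWallPos n (x + 1) y,
      (wall n).Adj (wallPos h) (wallPos h') := fun h' => ⟨h', wall_adj_horizontal _ _⟩
    have left : 1 ≤ x → IsWallPos n (x - 1) y → ∃ h' : IsWallPos n (x - 1) y,
        (wall n).Adj (wallPos h) (wallPos h') := by
      intro hx h'
      obtain ⟨x, rfl⟩ := Nat.exists_eq_add_of_le' hx
      exact ⟨h', (wall_adj_horizontal h' h).symm⟩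
    have up : Odd (x + y) → IsWallPos n x (y + 1) → ∃ h' : IsWallPos n x (y + 1),
      (wall n).Adj (wallPos h) (wallPos h') := fun ho h' => ⟨h', wall_adj_vertical _ _ ho⟩
    have down : Even (x + y) → 1 ≤ y → IsWallPos n x (y - 1) → ∃ h' : IsWallPos n x (y - 1),
        (wall n).Adj (wallPos h) (wallPos h') := by
      intro ho hy h'
      obtain ⟨y, rfl⟩ := Nat.exists_eq_add_of_le' hy
      exact ⟨h', (wall_adj_vertical h' h (by grind)).symm⟩
    have horizontal : (1 ≤ x ∧ IsWallPos n (x - 1) y) ∨ IsWallPos n (x + 1) y := by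
      unfold IsWallPos at *
      split_ifs at * <;> grind
    have vertical : (Odd (x + y) ∧ IsWallPos n x (y + 1)) ∨
        (Even (x + y) ∧ 1 ≤ y ∧ IsWallPos n x (y - 1)) ∨
        (1 ≤ x ∧ IsWallPos n (x - 1) y ∧ IsWallPos n (x + 1) y) := by
      unfold IsWallPos at *
      split_ifs at * <;> grind
    rcases vertical with ⟨ho, h1⟩ | ⟨he, hy, h1⟩ | ⟨hx, h1, h2⟩
    · obtain ⟨h1, a1⟩ := up ho h1
      rcases horizontal with ⟨hx, h2⟩ | h2
      · obtain ⟨h2, a2⟩ := left hx h2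
        exact ⟨_, _, by rw [Ne, wallPos_inj]; omega, a1, a2⟩
      · obtain ⟨h2, a2⟩ := right h2
        exact ⟨_, _, by rw [Ne, wallPos_inj]; omega, a1, a2⟩
    · obtain ⟨h1, a1⟩ := down he hy h1
      rcases horizontal with ⟨hx, h2⟩ | h2
      · obtain ⟨h2, a2⟩ := left hx h2
        exact ⟨_, _, by rw [Ne, wallPos_inj]; omega, a1, a2⟩
      · obtain ⟨h2, a2⟩ := right h2
        exact ⟨_, _, by rw [Ne, wallPos_inj]; omega, a1, a2⟩
    · obtain ⟨h1, a1⟩ := left hx h1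
      obtain ⟨h2, a2⟩ := right h2
      exact ⟨_, _, by rw [Ne, wallPos_inj]; omega, a1, a2⟩

/-- The `y`-th row of a wall. -/
def wallRow (n : ℕ) (y : Fin (n + 1)) : Set (WallVertex n) := {v | v.1.2 = y}

/-- The `j`-th column of a wall, which runs through the positions with `x = 2 * j` and
`x = 2 * j + 1`. -/
def wallColumn (n : ℕ) (j : Fin (n + 1)) : Set (WallVertex n) := {v | (v.1.1 : ℕ) / 2 = j}

/-- A set is connected if it has a vertex from which membership propagates in both directions. -/
theorem isConnectedIn_of_root {V : Type} {G : SimpleGraph V} {P : Set V} (r : V)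
    (h : ∀ X : Set V, (∀ p ∈ P, ∀ q ∈ P, G.Adj p q → (p ∈ X ↔ q ∈ X)) →
      ∀ p ∈ P, p ∈ X ↔ r ∈ X) : IsConnectedIn G P := by
  intro X hX p hp q hq hpX
  have := h X fun a ha b hb hab => ⟨hX a ha b hb hab, hX b hb a ha hab.symm⟩
  exact (this q hq).2 ((this p hp).1 hpX)

theorem isConnectedIn_wallRow (hn : 2 ≤ n) (y : Fin (n + 1)) :
    IsConnectedIn (wall n) (wallRow n y) := by
  -- The root has `x = 1` because the corner with `x = 0` may be deleted.
  have h1 : IsWallPos n 1 y := by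
    unfold IsWallPos
    split_ifs <;> grind
  refine isConnectedIn_of_root (wallPos h1) fun X hX => ?_
  have key : ∀ x (h : IsWallPos n (x + 1) y), wallPos h ∈ X ↔ wallPos h1 ∈ X := by
    intro x
    induction x with
    | zero => exact fun _ => Iff.rfl
    | succ x ih =>
      intro h
      have h' : IsWallPos n (x + 1) y := by
        unfold IsWallPos at *
        split_ifs at * <;> grind
      exact (hX _ rfl _ rfl (wall_adj_horizontal h' h)).symm.trans (ih h')
  intro p
  induction p using wallVertex_induction with
  | h x y' h =>
    intro hy
    obtain rfl : y' = y := congrArg Fin.val hy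
    rcases x with _ | x
    · exact hX _ rfl _ rfl (wall_adj_horizontal h h1)
    · exact key x h

theorem isConnectedIn_wallColumn (hn : 2 ≤ n) (j : Fin (n + 1)) :
    IsConnectedIn (wall n) (wallColumn n j) := by
  have h1 : IsWallPos n (2 * j + 1) 0 := by
    unfold IsWallPos
    split_ifs <;> grind
  refine isConnectedIn_of_root (wallPos h1) fun X hX => ?_
  have mem : ∀ {x y} (h : IsWallPos n x y), x / 2 = j → wallPos h ∈ wallColumn n j :=
    fun _ hx => hx
  have same_row : ∀ {x x' y} (h : IsWallPos n x y) (h' : IsWallPos n x' y), x / 2 = j →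
      x' / 2 = j → (wallPos h ∈ X ↔ wallPos h' ∈ X) := by
    intro x x' y h h' hx hx'
    rcases (by omega : x = x' ∨ x' = x + 1 ∨ x = x' + 1) with rfl | rfl | rfl
    · exact Iff.rfl
    · exact hX _ (mem h hx) _ (mem h' hx') (wall_adj_horizontal h h')
    · exact (hX _ (mem h' hx') _ (mem h hx) (wall_adj_horizontal h' h)).symm
  have key : ∀ y x (h : IsWallPos n x y), x / 2 = j → (wallPos h ∈ X ↔ wallPos h1 ∈ X) := by
    intro y
    induction y with
    | zero => exact fun x h hx => same_row h h1 hx (by omega)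
    | succ y ih =>
      intro x h hx
      -- The vertical edge from row `y` to row `y + 1` in this column: `b` is `2 * j + 1` for even
      -- `y` and `2 * j` for odd `y`. By parity it avoids both deleted corners.
      obtain ⟨b, hb, hodd, h2, h3⟩ : ∃ b : ℕ, b / 2 = j ∧ Odd (b + y) ∧ IsWallPos n b y ∧
          IsWallPos n b (y + 1) := by
        have hj := j.2
        have hy := h.2.1
        clear * - hj hy
        unfold IsWallPos
        rcases Nat.even_or_odd y with ho | ho
        · refine ⟨2 * j + 1, by omega, by grind, ?_⟩
          split_ifs <;> grind
        · refine ⟨2 * j, by omega, by grind, ?_⟩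
          split_ifs <;> grind
      exact (same_row h h3 hx hb).trans
        ((hX _ (mem h2 hb) _ (mem h3 hb) (wall_adj_vertical h2 h3 hodd)).symm.trans (ih b h2 hb))
  intro p
  induction p using wallVertex_induction with
  | h x y h => exact key y x h

theorem wallRow_inter_wallColumn_nonempty (hn : 2 ≤ n) (y j : Fin (n + 1)) :
    (wallRow n y ∩ wallColumn n j).Nonempty := by
  have h : IsWallPos n (2 * j) y ∨ IsWallPos n (2 * j + 1) y := by
    unfold IsWallPos
    split_ifs <;> grind
  rcases h with h | h
  · exact ⟨wallPos h, rfl, show 2 * (j : ℕ) / 2 = j by omega⟩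
  · exact ⟨wallPos h, rfl, show (2 * (j : ℕ) + 1) / 2 = j by omega⟩

theorem lt_cliqueWidth_wall {c : ℕ} (hn : 3 * c + 2 ≤ n) :
    c < cliqueWidth (cliqueSubdivisionWithApex (wall n)) :=
  lt_cliqueWidth_of_grid (m := n + 1) (by omega) (isConnectedIn_wallRow (by omega))
    (fun _ _ _ h h' => h.symm.trans h') (isConnectedIn_wallColumn (by omega))
    (fun _ _ _ h h' => Fin.ext (h.symm.trans h')) (wallRow_inter_wallColumn_nonempty (by omega))

end Wall

theorem mainTheorem8 :
    ¬ HasBoundedCliqueWidth FreeAtom ∧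
    (∀ n : ℕ, 2 ≤ n → FreeAtom _ (cliqueSubdivisionWithApex (wall n))) ∧
    (∀ c : ℕ, ∃ n : ℕ, 2 ≤ n ∧ c < cliqueWidth (cliqueSubdivisionWithApex (wall n))) := by
  have hfree : ∀ n : ℕ, 2 ≤ n → FreeAtom _ (cliqueSubdivisionWithApex (wall n)) := fun n hn =>
    ⟨compl_graphP2P3_free, compl_graphP1P2P2_free, graphP1P2P2_free, pathGraph_six_free,
      isAtomGraph_cliqueSubdivisionWithApex (wall_two_neighbors hn)⟩
  have hwidth : ∀ c : ℕ, ∃ n : ℕ, 2 ≤ n ∧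
      c < cliqueWidth (cliqueSubdivisionWithApex (wall n)) := fun c =>
    ⟨3 * c + 2, by omega, lt_cliqueWidth_wall le_rfl⟩
  refine ⟨?_, hfree, hwidth⟩
  rintro ⟨c, hc⟩
  obtain ⟨n, hn, h⟩ := hwidth c
  exact absurd (hc _ _ (hfree n hn)) (by omega)
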